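/- Let $H\neq\{0\}$ be a complex Hilbert space and let $B(H)^+$ be the set of positive semidefinite bounded operators on $H$, with the Loewner order. A symmetric Kubo–Ando mean on $B(H)^+$ is a map $\sigma: B(H)^+\times B(H)^+\to B(H)^+$ such that, for all $A,B,C,D\in B(H)^+$: $A\le C$ and $B\le D$ imply $A\sigma B\le C\sigma D$; $C(A\sigma B)C\le (CAC)\sigma(CBC)$; if $A_n\downarrow A$ and $B_n\downarrow B$ then $A_n\sigma B_n\downarrow A\sigma B$ (decreasing sequences in $B(H)^+$, strong convergence); $I\sigma I=I$; and $A\sigma B=B\sigma A$. A function $f:(0,\infty)\to[0,\infty)$ is operator monotone if, on every complex Hilbert space, $A\le B$ implies $f(A)\le f(B)$ for all positive invertible bounded operators $A,B$; it is the representing function of $\sigma$ if $I\sigma(xI)=f(x)I$ for all $x>0$. A Molnár mean is a symmetric Kubo–Ando mean that has an operator monotone representing function $f$ for which there is a scalar $c>0$, $c\neq1$, with $f(c^2x)=cf(x)$ for all $x>0$. Then there are infinitely many Molnár means on $B(H)^+$. Moreover, for every real $\alpha\neq0$ there is a Molnár mean on $B(H)^+$ with representing function $$f_\alpha(x)=\sqrt{x}\,\exp\left\{\frac{\pi\sin^2(\alpha\log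 x)}{\sinh(2\pi\alpha)}\right\},\qquad x>0,$$ and this mean is not the geometric mean $A\#B=A^{1/2}(A^{-1/2}BA^{-1/2})^{1/2}A^{1/2}$ ($A,B$ positive invertible). In particular, the answer to Molnár's question whether every Molnár mean is the geometric mean is negative. -/

import Mathlib

universe u

/-- `B(H)⁺`: the positive semidefinite bounded operators on `H`, with the Loewner order
(`A ≤ B` iff `B - A` is positive semidefinite). -/
abbrev PosOp (H : Type u) [NormedAddCommGroup H] [InnerProductSpace ℂ H] : Type u :=
  {A : H →L[ℂ] H // 0 ≤ A}

namespace PosOp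

variable {H : Type u} [NormedAddCommGroup H] [InnerProductSpace ℂ H]

/-- The identity operator `I`. -/
def id (H : Type u) [NormedAddCommGroup H] [InnerProductSpace ℂ H] : PosOp H :=
  ⟨1, (ContinuousLinearMap.nonneg_iff_isPositive 1).2 ContinuousLinearMap.isPositive_one⟩

/-- The scalar operator `x I`, for `x ≥ 0`. -/
def scalar (H : Type u) [NormedAddCommGroup H] [InnerProductSpace ℂ H]
    (x : ℝ) (hx : 0 ≤ x) : PosOp H :=
  ⟨(x : ℂ) • (1 : H →L[ℂ] H), by
    rw [ContinuousLinearMap.nonneg_iff_isPositive]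
    exact ContinuousLinearMap.isPositive_one.smul_of_nonneg (by exact_mod_cast hx)⟩

/-- The positive operator `C A C`, for positive `C` and `A`. -/
def conj [CompleteSpace H] (C A : PosOp H) : PosOp H :=
  ⟨C.1 * A.1 * C.1, (IsSelfAdjoint.of_nonneg C.2).conjugate_nonneg A.2⟩

/-- `A_n ↓ A`: the sequence `A_n` is decreasing and converges strongly to `A`. -/
def DecreasesTo (A : ℕ → PosOp H) (L : PosOp H) : Prop :=
  Antitone A ∧ ∀ v : H, Filter.Tendsto (fun n => (A n).1 v) Filter.atTop (nhds (L.1 v))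

end PosOp

section

variable {H : Type u} [NormedAddCommGroup H] [InnerProductSpace ℂ H] [CompleteSpace H]

/-- A connection on `B(H)⁺`. -/
structure IsConnection (σ : PosOp H → PosOp H → PosOp H) : Prop where
  joint_monotone : ∀ A B C D : PosOp H, A ≤ C → B ≤ D → σ A B ≤ σ C D
  transformer : ∀ A B C : PosOp H, PosOp.conj C (σ A B) ≤ σ (PosOp.conj C A) (PosOp.conj C B)
  upper_semicontinuous : ∀ (A B : ℕ → PosOp H) (A₀ B₀ : PosOp H),
    PosOp.DecreasesTo A A₀ → PosOp.DecreasesTo B B₀ →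
      PosOp.DecreasesTo (fun n => σ (A n) (B n)) (σ A₀ B₀)

/-- A symmetric Kubo-Ando mean on `B(H)⁺`. -/
structure IsSymmetricKuboAndoMean (σ : PosOp H → PosOp H → PosOp H) : Prop
    extends IsConnection σ where
  normalized : σ (PosOp.id H) (PosOp.id H) = PosOp.id H
  symmetric : ∀ A B : PosOp H, σ A B = σ B A

/-- `f` represents `σ`: `I σ (x I) = f(x) I` for all `x > 0`. Only the values of `f` on
`(0, ∞)` matter. -/
def IsRepresentingFunction (f : ℝ → ℝ) (σ : PosOp H → PosOp H → PosOp H) : Prop :=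
  ∀ (x : ℝ) (hx : 0 < x),
    (σ (PosOp.id H) (PosOp.scalar H x hx.le)).1 = ((f x : ℝ) : ℂ) • (1 : H →L[ℂ] H)

end

/-- Positive operator monotone functions `(0, ∞) → [0, ∞)`: on every complex Hilbert space `K`,
`A ≤ B` implies `f(A) ≤ f(B)` for positive invertible `A, B`.

The continuous functional calculus `cfc f A` has its intended value for every `f` as soon as `K` is
finite-dimensional (the spectrum is then finite). As a function that is monotone on positive
definite `2 × 2` matrices is continuous on `(0, ∞)`, the condition on finite-dimensional `K`
already forces continuity, and then `cfc f A` has its intended value on every `K`. -/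
def IsPositiveOperatorMonotone (f : ℝ → ℝ) : Prop :=
  (∀ x : ℝ, 0 < x → 0 ≤ f x) ∧
  ∀ (K : Type u) [NormedAddCommGroup K] [InnerProductSpace ℂ K] [CompleteSpace K]
    (A B : K →L[ℂ] K), 0 ≤ A → IsUnit A → 0 ≤ B → IsUnit B → A ≤ B → cfc f A ≤ cfc f B

section

variable {H : Type u} [NormedAddCommGroup H] [InnerProductSpace ℂ H] [CompleteSpace H]

/-- A Molnár mean: a symmetric Kubo-Ando mean whose representing operator monotone function `f`
satisfies `f(c²x) = c f(x)`, `x > 0`, for some positive scalar `c ≠ 1`. -/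
def IsMolnarMean (σ : PosOp H → PosOp H → PosOp H) : Prop :=
  IsSymmetricKuboAndoMean σ ∧
  ∃ f : ℝ → ℝ, IsPositiveOperatorMonotone.{u} f ∧ IsRepresentingFunction f σ ∧
    ∃ c : ℝ, 0 < c ∧ c ≠ 1 ∧ ∀ x : ℝ, 0 < x → f (c ^ 2 * x) = c * f x

/-- `σ` is the geometric mean: `A σ B = A^{1/2} (A^{-1/2} B A^{-1/2})^{1/2} A^{1/2}` for positive
invertible `A`, `B`. (The values of a connection on `B(H)⁺` are determined by those on positive
invertible operators.) -/
def IsGeometricMean (σ : PosOp H → PosOp H → PosOp H) : Prop :=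
  ∀ A B : PosOp H, IsUnit A.1 → IsUnit B.1 →
    (σ A B).1 = CFC.sqrt A.1 *
      CFC.sqrt (Ring.inverse (CFC.sqrt A.1) * B.1 * Ring.inverse (CFC.sqrt A.1)) * CFC.sqrt A.1

end

/-- `f_α(x) = √x · exp(π sin²(α log x) / sinh(2πα))`. -/
noncomputable def molnarExample (α x : ℝ) : ℝ :=
  √x * Real.exp (Real.pi * Real.sin (α * Real.log x) ^ 2 / Real.sinh (2 * Real.pi * α))

/-! Integrating the parallel sums $(e^{s/2}A):(e^{-s/2}B)$ against a bounded continuous density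
$w\ge 0$ that is even and suitably normalized gives a symmetric Kubo–Ando mean: every axiom holds
for the parallel sum and survives integration. Its representing function is $\int w(s)\,k(s,x)\,ds$,
where $k(s,x)=x/(e^{s/2}+e^{-s/2}x)$ is operator monotone in $x$.

It remains to find $w\ge0$ that yields $f_\alpha$. The shift $s\mapsto s+\log x$ turns $k(s,x)$ into
$\sqrt x/(2\cosh(s/2))$, and $1/\cosh(s/2)$ is the Poisson kernel, up to a constant, for the centre
of the strip $|\mathrm{Im}\,z|\le\pi$ (`integral_strip_boundary`). So $w$ is read off from the
boundary values of the entire function $\exp(\kappa\sin^2(\alpha z))$, which is bounded on the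
strip. With $\kappa=\pi/\sinh(2\pi\alpha)$ the phase on the boundary is
$\pm\frac{\pi}{2}\sin(2\alpha s)$, so that the real part is nonnegative (`exp_sin_sq_boundary`).

Since $\sin^2(\alpha\log x)$ is unchanged when $\alpha\log x$ grows by $\pi$, the functional
equation holds with $c=e^{\pi/(2\alpha)}$. The points where $f_\alpha(x)=\sqrt x$ separate these
means from the geometric mean and from one another. -/

set_option linter.unusedSectionVars false

open scoped InnerProductSpace ComplexOrder
open MeasureTheory

/-! ### Quadratic forms and the parallel sum -/

section

variable {H : Type u} [NormedAddCommGroup H] [InnerProductSpace ℂ H] [CompleteSpace H]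

lemma le_iff_reApplyInnerSelf_le {A B : H →L[ℂ] H} (hA : IsSelfAdjoint A) (hB : IsSelfAdjoint B) :
    A ≤ B ↔ ∀ x, A.reApplyInnerSelf x ≤ B.reApplyInnerSelf x := by
  rw [ContinuousLinearMap.le_def, ContinuousLinearMap.isPositive_def']
  simp [hB.sub hA, ContinuousLinearMap.reApplyInnerSelf_apply, inner_sub_left]

lemma reApplyInnerSelf_mono {A B : H →L[ℂ] H} (h : A ≤ B) (x : H) :
    A.reApplyInnerSelf x ≤ B.reApplyInnerSelf x := by
  have := (ContinuousLinearMap.isPositive_def'.1 ((ContinuousLinearMap.le_def A B).1 h)).2 x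
  simpa [ContinuousLinearMap.reApplyInnerSelf_apply, inner_sub_left] using this

lemma reApplyInnerSelf_nonneg {A : H →L[ℂ] H} (h : 0 ≤ A) (x : H) : 0 ≤ A.reApplyInnerSelf x := by
  simpa [ContinuousLinearMap.reApplyInnerSelf_apply] using reApplyInnerSelf_mono h x

lemma norm_sqrt_apply_sq {A : H →L[ℂ] H} (hA : 0 ≤ A) (x : H) :
    ‖CFC.sqrt A x‖ ^ 2 = A.reApplyInnerSelf x := by
  have h : IsSelfAdjoint (CFC.sqrt A) := .of_nonneg (CFC.sqrt_nonneg A)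
  nth_rw 2 [← CFC.sqrt_mul_sqrt_self A hA]
  rw [ContinuousLinearMap.reApplyInnerSelf_apply, mul_apply_eq_comp,
    ← ContinuousLinearMap.adjoint_inner_right, ← ContinuousLinearMap.star_eq_adjoint, h.star_eq,
    inner_self_eq_norm_sq]

/-- Existence of the operator whose quadratic form is the infimal convolution of the quadratic
forms of `A` and `B`. -/
lemma exists_parallelSum {A B : H →L[ℂ] H} (hA : 0 ≤ A) (hB : 0 ≤ B) :
    ∃ P : H →L[ℂ] H, 0 ≤ P ∧
      (∀ x y, P.reApplyInnerSelf x ≤ A.reApplyInnerSelf y + B.reApplyInnerSelf (x - y)) ∧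
      ∀ x, ∀ ε > 0, ∃ y,
        A.reApplyInnerSelf y + B.reApplyInnerSelf (x - y) < P.reApplyInnerSelf x + ε := by
  let e : (H × H) →L[ℂ] WithLp 2 (H × H) :=
    (WithLp.prodContinuousLinearEquiv 2 ℂ H H).symm.toContinuousLinearMap
  -- Here $Jx+Dy=(\sqrt A\,y,\sqrt B(x-y))$, so the infimal convolution at $x$ is the squared
  -- distance from $Jx$ to the closure $M$ of the range of $D$. That distance is the norm of the
  -- projection of $Jx$ onto $M^\perp$, whence the operator $J^*P_{M^\perp}J$. No inverses are
  -- needed.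
  let D : H →L[ℂ] WithLp 2 (H × H) := e.comp ((CFC.sqrt A).prod (-CFC.sqrt B))
  let J : H →L[ℂ] WithLp 2 (H × H) := e.comp ((0 : H →L[ℂ] H).prod (CFC.sqrt B))
  let M : Submodule ℂ (WithLp 2 (H × H)) := D.range.topologicalClosure
  have hM : IsClosed (M : Set (WithLp 2 (H × H))) := Submodule.isClosed_topologicalClosure _
  have : CompleteSpace M := hM.completeSpace_coe
  have hDM (y : H) : D y ∈ M := Submodule.le_topologicalClosure _ ⟨y, rfl⟩
  have key (x y : H) : ‖J x + D y‖ ^ 2 = A.reApplyInnerSelf y + B.reApplyInnerSelf (x - y) := by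
    rw [WithLp.prod_norm_sq_eq_of_L2, ← norm_sqrt_apply_sq hA, ← norm_sqrt_apply_sq hB]
    simp [J, D, e, sub_eq_add_neg]
  have hPP (v : WithLp 2 (H × H)) : RCLike.re ⟪Mᗮ.starProjection v, v⟫_ℂ
      = ‖Mᗮ.starProjection v‖ ^ 2 := by
    rw [← inner_self_eq_norm_sq (𝕜 := ℂ), ← Submodule.inner_starProjection_left_eq_right,
      Submodule.starProjection_eq_self_iff.2 (Submodule.starProjection_apply_mem _ _)]
  have hq (x : H) : (J.adjoint.comp (Mᗮ.starProjection.comp J)).reApplyInnerSelf x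
      = ‖Mᗮ.starProjection (J x)‖ ^ 2 := by
    rw [ContinuousLinearMap.reApplyInnerSelf_apply, ← hPP, ContinuousLinearMap.comp_apply,
      ContinuousLinearMap.adjoint_inner_left, ContinuousLinearMap.comp_apply]
  refine ⟨J.adjoint.comp (Mᗮ.starProjection.comp J), ?_, fun x y => ?_, fun x ε hε => ?_⟩
  · rw [ContinuousLinearMap.nonneg_iff_isPositive]
    refine ContinuousLinearMap.IsPositive.adjoint_conj ?_ J
    exact ContinuousLinearMap.IsPositive.of_isStarProjection isStarProjection_starProjection
  · rw [hq, ← key]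
    have : Mᗮ.starProjection (J x) = Mᗮ.starProjection (J x + D y) := by
      rw [map_add, left_eq_add, Submodule.starProjection_apply_eq_zero_iff]
      exact Submodule.le_orthogonal_orthogonal _ (hDM y)
    rw [this]
    gcongr
    exact Submodule.norm_starProjection_apply_le _ _
  · have hmem : -(M.starProjection (J x)) ∈ closure (Set.range D) := by
      have : -(M.starProjection (J x)) ∈ M := M.neg_mem (Submodule.starProjection_apply_mem _ _)
      rwa [← SetLike.mem_coe, Submodule.topologicalClosure_coe, LinearMap.coe_range] at this
    have hcont : Continuous fun z => ‖J x + z‖ ^ 2 := by fun_prop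
    have hlt : -(M.starProjection (J x)) ∈
        {z | ‖J x + z‖ ^ 2 < ‖Mᗮ.starProjection (J x)‖ ^ 2 + ε} := by
      have : Mᗮ.starProjection (J x) = J x + -(M.starProjection (J x)) := by
        rw [Submodule.starProjection_orthogonal_val, sub_eq_add_neg]
      simp [this, hε]
    obtain ⟨_, hz, ⟨y, rfl⟩⟩ := mem_closure_iff.1 hmem _ (isOpen_lt hcont continuous_const) hlt
    exact ⟨y, by rw [hq, ← key]; exact hz⟩


/-- The parallel sum `A : B` of two positive operators. -/
noncomputable def parallelSum (A B : PosOp H) : PosOp H :=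
  ⟨(exists_parallelSum A.2 B.2).choose, (exists_parallelSum A.2 B.2).choose_spec.1⟩

lemma parallelSum_quad_le (A B : PosOp H) (x y : H) :
    (parallelSum A B).1.reApplyInnerSelf x ≤
      A.1.reApplyInnerSelf y + B.1.reApplyInnerSelf (x - y) :=
  (exists_parallelSum A.2 B.2).choose_spec.2.1 x y

lemma exists_quad_lt_parallelSum_add (A B : PosOp H) (x : H) {ε : ℝ} (hε : 0 < ε) :
    ∃ y, A.1.reApplyInnerSelf y + B.1.reApplyInnerSelf (x - y) <
      (parallelSum A B).1.reApplyInnerSelf x + ε :=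
  (exists_parallelSum A.2 B.2).choose_spec.2.2 x ε hε

namespace PosOp

lemma isSelfAdjoint (A : PosOp H) : IsSelfAdjoint A.1 := .of_nonneg A.2

lemma le_iff_quad {A B : PosOp H} :
    A ≤ B ↔ ∀ x, A.1.reApplyInnerSelf x ≤ B.1.reApplyInnerSelf x :=
  le_iff_reApplyInnerSelf_le A.isSelfAdjoint B.isSelfAdjoint

/-- The positive multiple `e^s A` of a positive operator. -/
noncomputable def expSMul (s : ℝ) (A : PosOp H) : PosOp H :=
  ⟨((Real.exp s : ℝ) : ℂ) • A.1, by
    rw [ContinuousLinearMap.nonneg_iff_isPositive]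
    exact ((ContinuousLinearMap.nonneg_iff_isPositive _).1 A.2).smul_of_nonneg
      (by exact_mod_cast (Real.exp_pos s).le)⟩

lemma quad_expSMul (s : ℝ) (A : PosOp H) (x : H) :
    (expSMul s A).1.reApplyInnerSelf x = Real.exp s * A.1.reApplyInnerSelf x := by
  simp [expSMul, ContinuousLinearMap.reApplyInnerSelf_apply,
    -Complex.ofReal_exp]

lemma quad_scalar (a : ℝ) (ha : 0 ≤ a) (x : H) :
    (scalar H a ha).1.reApplyInnerSelf x = a * ‖x‖ ^ 2 := by
  simp [scalar, ContinuousLinearMap.reApplyInnerSelf_apply,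
    inner_self_eq_norm_sq_to_K, ← Complex.ofReal_pow]

lemma quad_conj (C A : PosOp H) (x : H) :
    (conj C A).1.reApplyInnerSelf x = A.1.reApplyInnerSelf (C.1 x) := by
  have h : ContinuousLinearMap.adjoint C.1 = C.1 := by
    rw [← ContinuousLinearMap.star_eq_adjoint, C.isSelfAdjoint.star_eq]
  rw [ContinuousLinearMap.reApplyInnerSelf_apply, ContinuousLinearMap.reApplyInnerSelf_apply]
  nth_rw 2 [← h]
  rw [ContinuousLinearMap.adjoint_inner_right]
  rfl

end PosOp

/-- With `parallelSum_quad_le`, this makes the parallel sum the largest positive operator whose form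
lies below the infimal convolution. Monotonicity, symmetry and the transformer inequality then
reduce to comparing forms. -/
lemma le_parallelSum {A B R : PosOp H}
    (h : ∀ x y, R.1.reApplyInnerSelf x ≤ A.1.reApplyInnerSelf y + B.1.reApplyInnerSelf (x - y)) :
    R ≤ parallelSum A B := by
  refine PosOp.le_iff_quad.2 fun x => le_of_forall_pos_lt_add fun ε hε => ?_
  obtain ⟨y, hy⟩ := exists_quad_lt_parallelSum_add A B x hε
  exact (h x y).trans_lt hy

lemma parallelSum_mono {A B C D : PosOp H} (h₁ : A ≤ C) (h₂ : B ≤ D) :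
    parallelSum A B ≤ parallelSum C D :=
  le_parallelSum fun x y => (parallelSum_quad_le A B x y).trans
    (add_le_add (PosOp.le_iff_quad.1 h₁ y) (PosOp.le_iff_quad.1 h₂ (x - y)))

lemma parallelSum_comm (A B : PosOp H) : parallelSum A B = parallelSum B A := by
  have key (A B : PosOp H) : parallelSum A B ≤ parallelSum B A := le_parallelSum fun x y => by
    simpa [add_comm] using parallelSum_quad_le A B x (x - y)
  exact le_antisymm (key A B) (key B A)

lemma conj_parallelSum_le (A B C : PosOp H) :
    PosOp.conj C (parallelSum A B) ≤ parallelSum (PosOp.conj C A) (PosOp.conj C B) :=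
  le_parallelSum fun x y => by
    simpa [PosOp.quad_conj] using parallelSum_quad_le A B (C.1 x) (C.1 y)

lemma parallelSum_le_left (A B : PosOp H) : parallelSum A B ≤ A :=
  PosOp.le_iff_quad.2 fun x => by
    simpa [ContinuousLinearMap.reApplyInnerSelf_apply] using parallelSum_quad_le A B x x

lemma parallelSum_le_right (A B : PosOp H) : parallelSum A B ≤ B := by
  rw [parallelSum_comm]; exact parallelSum_le_left B A

lemma expSMul_parallelSum (s : ℝ) (A B : PosOp H) :
    PosOp.expSMul s (parallelSum A B) = parallelSum (PosOp.expSMul s A) (PosOp.expSMul s B) := by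
  refine le_antisymm (le_parallelSum fun x y => ?_) (PosOp.le_iff_quad.2 fun x => ?_)
  · simp only [PosOp.quad_expSMul, ← mul_add]
    gcongr
    exact parallelSum_quad_le A B x y
  · refine le_of_forall_pos_lt_add fun ε hε => ?_
    obtain ⟨y, hy⟩ := exists_quad_lt_parallelSum_add A B x (div_pos hε (Real.exp_pos s))
    refine (parallelSum_quad_le _ _ x y).trans_lt ?_
    simp only [PosOp.quad_expSMul, ← mul_add]
    refine (mul_lt_mul_of_pos_left hy (Real.exp_pos s)).trans_eq ?_
    field_simp

lemma parallelSum_scalar {a b : ℝ} (ha : 0 < a) (hb : 0 < b) :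
    parallelSum (PosOp.scalar H a ha.le) (PosOp.scalar H b hb.le) =
      PosOp.scalar H (a * b / (a + b)) (by positivity) := by
  have hab : 0 < a + b := by positivity
  refine le_antisymm (PosOp.le_iff_quad.2 fun x => ?_) (le_parallelSum fun x y => ?_)
  -- This $y$ minimizes $a\|y\|^2+b\|x-y\|^2$.
  · refine (parallelSum_quad_le _ _ x (((b / (a + b) : ℝ) : ℂ) • x)).trans_eq ?_
    have : x - ((b / (a + b) : ℝ) : ℂ) • x = ((a / (a + b) : ℝ) : ℂ) • x := by
      rw [sub_eq_iff_eq_add, ← add_smul, ← Complex.ofReal_add, ← add_div, div_self hab.ne']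
      simp
    rw [this]
    simp only [PosOp.quad_scalar, norm_smul, Complex.norm_real, Real.norm_eq_abs, mul_pow, sq_abs]
    field_simp
    ring
  · simp only [PosOp.quad_scalar]
    have h1 : ‖x‖ ≤ ‖y‖ + ‖x - y‖ := by simpa using norm_add_le y (x - y)
    have h2 : ‖x‖ ^ 2 ≤ (‖y‖ + ‖x - y‖) ^ 2 := by gcongr
    rw [div_mul_eq_mul_div, div_le_iff₀ hab]
    -- With $p=\|y\|$, $q=\|x-y\|$: $(a+b)(ap^2+bq^2)=ab(p+q)^2+(ap-bq)^2$.
    nlinarith [sq_nonneg (a * ‖y‖ - b * ‖x - y‖), mul_le_mul_of_nonneg_left h2 (mul_pos ha hb).le]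

lemma PosOp.DecreasesTo.tendsto_quad {A : ℕ → PosOp H} {L : PosOp H} (h : PosOp.DecreasesTo A L)
    (x : H) : Filter.Tendsto (fun k => (A k).1.reApplyInnerSelf x) Filter.atTop
      (nhds (L.1.reApplyInnerSelf x)) :=
  (Complex.continuous_re.tendsto _).comp ((h.2 x).inner tendsto_const_nhds)

lemma PosOp.DecreasesTo.le {A : ℕ → PosOp H} {L : PosOp H} (h : PosOp.DecreasesTo A L) (n : ℕ) :
    L ≤ A n :=
  PosOp.le_iff_quad.2 fun x => le_of_tendsto (h.tendsto_quad x)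
    (Filter.eventually_atTop.2 ⟨n, fun _ hk => PosOp.le_iff_quad.1 (h.1 hk) x⟩)

lemma norm_apply_sq_le_quad {A : H →L[ℂ] H} (hA : 0 ≤ A) (x : H) :
    ‖A x‖ ^ 2 ≤ ‖CFC.sqrt A‖ ^ 2 * A.reApplyInnerSelf x := by
  rw [← norm_sqrt_apply_sq hA, ← mul_pow]
  gcongr
  nth_rw 1 [← CFC.sqrt_mul_sqrt_self A hA]
  exact (CFC.sqrt A).le_opNorm _

lemma norm_sqrt_sq {A : H →L[ℂ] H} (hA : 0 ≤ A) : ‖CFC.sqrt A‖ ^ 2 = ‖A‖ := by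
  have h : IsSelfAdjoint (CFC.sqrt A) := .of_nonneg (CFC.sqrt_nonneg A)
  rw [sq, ← CStarRing.norm_star_mul_self, h.star_eq, CFC.sqrt_mul_sqrt_self A hA]

/-- For $T\ge0$ one has $\|Tv\|^2\le\|T\|\langle Tv,v\rangle$. Applied to $T=A_n-L$, whose norm is
at most that of $A_0-L$, it upgrades convergence of forms to strong convergence. -/
lemma PosOp.decreasesTo_of_tendsto_quad {A : ℕ → PosOp H} {L : PosOp H} (hA : Antitone A)
    (hL : ∀ n, L ≤ A n) (h : ∀ x, Filter.Tendsto (fun k => (A k).1.reApplyInnerSelf x) Filter.atTop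
      (nhds (L.1.reApplyInnerSelf x))) : PosOp.DecreasesTo A L := by
  refine ⟨hA, fun v => ?_⟩
  have h0 (n : ℕ) : 0 ≤ (A n).1 - L.1 := sub_nonneg.2 (hL n)
  have hb (n : ℕ) : ‖(A n).1 - L.1‖ ≤ ‖(A 0).1 - L.1‖ :=
    CStarAlgebra.norm_le_norm_of_nonneg_of_le (h0 n)
      (sub_le_sub_right (show (A n).1 ≤ (A 0).1 from hA (Nat.zero_le n)) L.1)
  have hq (n : ℕ) : ((A n).1 - L.1).reApplyInnerSelf v =
      (A n).1.reApplyInnerSelf v - L.1.reApplyInnerSelf v := by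
    simp [ContinuousLinearMap.reApplyInnerSelf_apply, inner_sub_left]
  have hlim : Filter.Tendsto (fun n => ‖(A 0).1 - L.1‖ *
      ((A n).1.reApplyInnerSelf v - L.1.reApplyInnerSelf v)) Filter.atTop (nhds 0) := by
    simpa using ((h v).sub_const (L.1.reApplyInnerSelf v)).const_mul (‖(A 0).1 - L.1‖)
  have hsq : Filter.Tendsto (fun n => ‖(A n).1 v - L.1 v‖ ^ 2) Filter.atTop (nhds 0) := by
    refine squeeze_zero (fun n => by positivity) (fun n => ?_) hlim
    have := norm_apply_sq_le_quad (h0 n) v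
    rw [norm_sqrt_sq (h0 n), hq] at this
    refine this.trans (mul_le_mul_of_nonneg_right (hb n) ?_)
    rw [← hq]
    exact reApplyInnerSelf_nonneg (h0 n) v
  rw [tendsto_iff_norm_sub_tendsto_zero]
  simpa [Function.comp_def, Real.sqrt_sq] using (Real.continuous_sqrt.tendsto _).comp hsq

lemma PosOp.DecreasesTo.parallelSum {A B : ℕ → PosOp H} {A₀ B₀ : PosOp H}
    (hA : PosOp.DecreasesTo A A₀) (hB : PosOp.DecreasesTo B B₀) :
    PosOp.DecreasesTo (fun n => parallelSum (A n) (B n)) (parallelSum A₀ B₀) := by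
  have hle (n : ℕ) := parallelSum_mono (hA.le n) (hB.le n)
  refine decreasesTo_of_tendsto_quad (fun m n h => parallelSum_mono (hA.1 h) (hB.1 h)) hle
    fun x => tendsto_order.2 ⟨fun a ha => ?_, fun a ha => ?_⟩
  · exact Filter.Eventually.of_forall fun n => ha.trans_le (PosOp.le_iff_quad.1 (hle n) x)
  -- A nearly optimal $y$ for the limit is a test vector for every $n$.
  · obtain ⟨y, hy⟩ := exists_quad_lt_parallelSum_add A₀ B₀ x (sub_pos.2 ha)
    rw [add_sub_cancel] at hy
    filter_upwards [((hA.tendsto_quad y).add (hB.tendsto_quad (x - y))).eventually_lt_const hy]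
      with n hn
    exact (parallelSum_quad_le _ _ x y).trans_lt hn

lemma PosOp.DecreasesTo.expSMul {A : ℕ → PosOp H} {L : PosOp H} (h : PosOp.DecreasesTo A L)
    (s : ℝ) : PosOp.DecreasesTo (fun n => PosOp.expSMul s (A n)) (PosOp.expSMul s L) := by
  refine ⟨fun m n hmn => PosOp.le_iff_quad.2 fun x => ?_, fun v => ?_⟩
  · simp only [PosOp.quad_expSMul]
    gcongr
    exact PosOp.le_iff_quad.1 (h.1 hmn) x
  · exact (h.2 v).const_smul ((Real.exp s : ℝ) : ℂ)

end

/-! ### Means as integrals of parallel sums -/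

lemma integrable_exp_neg_abs_half : Integrable fun s : ℝ => Real.exp (-(|s| / 2)) := by
  rw [← integrableOn_univ, ← Set.Iic_union_Ioi (a := (0 : ℝ))]
  refine IntegrableOn.union ?_ ?_
  · refine (integrableOn_exp_mul_Iic (a := 1 / 2) (by norm_num) 0).congr_fun
      (fun s (hs : s ≤ 0) => ?_) measurableSet_Iic
    simp only [abs_of_nonpos hs]
    ring_nf
  · refine (exp_neg_integrableOn_Ioi 0 (b := 1 / 2) (by norm_num)).congr_fun
      (fun s (hs : 0 < s) => ?_) measurableSet_Ioi
    simp only [abs_of_pos hs]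
    ring_nf

section

variable {H : Type u} [NormedAddCommGroup H] [InnerProductSpace ℂ H] [CompleteSpace H]

/-- The parallel sum `(e^{s/2} A) : (e^{-s/2} B)`. -/
noncomputable def balancedSum (A B : PosOp H) (s : ℝ) : PosOp H :=
  parallelSum (PosOp.expSMul (s / 2) A) (PosOp.expSMul (-(s / 2)) B)

lemma PosOp.expSMul_mono {s t : ℝ} (h : s ≤ t) {A B : PosOp H} (hAB : A ≤ B) :
    PosOp.expSMul s A ≤ PosOp.expSMul t B :=
  PosOp.le_iff_quad.2 fun x => by
    simp only [PosOp.quad_expSMul]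
    have := reApplyInnerSelf_nonneg A.2 x
    have := PosOp.le_iff_quad.1 hAB x
    gcongr

lemma PosOp.expSMul_expSMul (s t : ℝ) (A : PosOp H) :
    PosOp.expSMul s (PosOp.expSMul t A) = PosOp.expSMul (s + t) A := by
  simp [PosOp.expSMul, smul_smul, Complex.exp_add]

lemma balancedSum_mono {A B C D : PosOp H} (h₁ : A ≤ C) (h₂ : B ≤ D) (s : ℝ) :
    balancedSum A B s ≤ balancedSum C D s :=
  parallelSum_mono (PosOp.expSMul_mono le_rfl h₁) (PosOp.expSMul_mono le_rfl h₂)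

/-- Passing from $s$ to $t$ multiplies each scaling factor by at most $e^{|t-s|/2}$. Used in both
directions, this gives norm continuity in $s$. -/
lemma balancedSum_le_expSMul (A B : PosOp H) (s t : ℝ) :
    balancedSum A B t ≤ PosOp.expSMul (|t - s| / 2) (balancedSum A B s) := by
  rw [balancedSum, balancedSum, expSMul_parallelSum, PosOp.expSMul_expSMul, PosOp.expSMul_expSMul]
  refine parallelSum_mono (PosOp.expSMul_mono ?_ le_rfl) (PosOp.expSMul_mono ?_ le_rfl)
  · linarith [le_abs_self (t - s)]
  · linarith [neg_abs_le (t - s)]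

lemma PosOp.norm_expSMul (s : ℝ) (A : PosOp H) :
    ‖(PosOp.expSMul s A).1‖ = Real.exp s * ‖A.1‖ := by
  rw [PosOp.expSMul, norm_smul, Complex.norm_real, Real.norm_eq_abs, Real.abs_exp]

lemma PosOp.norm_mono {A B : PosOp H} (h : A ≤ B) : ‖A.1‖ ≤ ‖B.1‖ :=
  CStarAlgebra.norm_le_norm_of_nonneg_of_le A.2 h

/-- A parallel sum lies below both arguments; the one whose scaling factor decays is used, according
to the sign of $s$. This makes the defining integral of the mean converge. -/
lemma norm_balancedSum_le (A B : PosOp H) (s : ℝ) :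
    ‖(balancedSum A B s).1‖ ≤ Real.exp (-(|s| / 2)) * (‖A.1‖ + ‖B.1‖) := by
  rcases le_total 0 s with h | h
  · rw [abs_of_nonneg h]
    refine (PosOp.norm_mono (parallelSum_le_right _ _)).trans ?_
    rw [PosOp.norm_expSMul]
    gcongr
    exact le_add_of_nonneg_left (norm_nonneg _)
  · rw [abs_of_nonpos h]
    refine (PosOp.norm_mono (parallelSum_le_left _ _)).trans ?_
    rw [PosOp.norm_expSMul, neg_div, neg_neg]
    gcongr
    exact le_add_of_nonneg_right (norm_nonneg _)

lemma norm_balancedSum_sub_le (A B : PosOp H) (s t : ℝ) :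
    ‖(balancedSum A B t).1 - (balancedSum A B s).1‖ ≤
      (Real.exp (|t - s| / 2) - Real.exp (-(|t - s| / 2))) * ‖(balancedSum A B s).1‖ +
      (1 - Real.exp (-(|t - s| / 2))) * ‖(balancedSum A B s).1‖ := by
  set d := |t - s| / 2 with hd
  have hd0 : 0 ≤ d := by positivity
  set P := balancedSum A B s
  set Q := balancedSum A B t
  have h1 : Q ≤ PosOp.expSMul d P := balancedSum_le_expSMul A B s t
  have h2 : PosOp.expSMul (-d) P ≤ Q := by
    have := PosOp.expSMul_mono (le_refl (-d)) (balancedSum_le_expSMul A B t s)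
    rwa [PosOp.expSMul_expSMul, abs_sub_comm, ← hd, neg_add_cancel,
      show PosOp.expSMul 0 (balancedSum A B t) = Q by simp [PosOp.expSMul, Q]] at this
  have h3 : ‖Q.1 - (PosOp.expSMul (-d) P).1‖ ≤
      ‖(PosOp.expSMul d P).1 - (PosOp.expSMul (-d) P).1‖ :=
    CStarAlgebra.norm_le_norm_of_nonneg_of_le (sub_nonneg.2 h2)
      (sub_le_sub_right (show Q.1 ≤ (PosOp.expSMul d P).1 from h1) _)
  have h4 : ‖(PosOp.expSMul d P).1 - (PosOp.expSMul (-d) P).1‖ =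
      (Real.exp d - Real.exp (-d)) * ‖P.1‖ := by
    rw [PosOp.expSMul, PosOp.expSMul, ← sub_smul, norm_smul, ← Complex.ofReal_sub,
      Complex.norm_real, Real.norm_of_nonneg]
    exact sub_nonneg.2 (Real.exp_le_exp.2 (by linarith))
  have h5 : ‖(PosOp.expSMul (-d) P).1 - P.1‖ = (1 - Real.exp (-d)) * ‖P.1‖ := by
    have : (PosOp.expSMul (-d) P).1 - P.1 = ((Real.exp (-d) - 1 : ℝ) : ℂ) • P.1 := by
      simp [PosOp.expSMul, sub_smul]
    rw [this, norm_smul, Complex.norm_real, Real.norm_of_nonpos, neg_sub]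
    exact sub_nonpos.2 (Real.exp_le_one_iff.2 (by linarith))
  calc ‖Q.1 - P.1‖ ≤ ‖Q.1 - (PosOp.expSMul (-d) P).1‖ + ‖(PosOp.expSMul (-d) P).1 - P.1‖ :=
        norm_sub_le_norm_sub_add_norm_sub _ _ _
    _ ≤ _ := by rw [h5, ← h4]; gcongr

lemma continuous_balancedSum (A B : PosOp H) : Continuous fun s => (balancedSum A B s).1 := by
  refine continuous_iff_continuousAt.2 fun s => tendsto_iff_norm_sub_tendsto_zero.2 ?_
  refine squeeze_zero (fun _ => norm_nonneg _) (fun t => norm_balancedSum_sub_le A B s t) ?_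
  have h : Continuous fun t : ℝ =>
      (Real.exp (|t - s| / 2) - Real.exp (-(|t - s| / 2))) * ‖(balancedSum A B s).1‖ +
      (1 - Real.exp (-(|t - s| / 2))) * ‖(balancedSum A B s).1‖ := by fun_prop
  simpa using h.tendsto s

/-- The scalar parallel sum `e^{s/2} : (e^{-s/2} x)`. -/
noncomputable def balancedKernel (s x : ℝ) : ℝ :=
  x / (Real.exp (s / 2) + Real.exp (-(s / 2)) * x)

/-- Densities of the measures representing the means constructed here. -/
structure MeanWeight where
  /-- the density -/
  density : ℝ → ℝ
  continuous : Continuous density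
  nonneg : ∀ s, 0 ≤ density s
  bounded : ∃ C, ∀ s, density s ≤ C
  even : ∀ s, density (-s) = density s
  normalized : ∫ s, density s * balancedKernel s 1 = 1

namespace MeanWeight

variable (w : MeanWeight)

/-- The function represented by the weight. -/
noncomputable def repr (x : ℝ) : ℝ := ∫ s, w.density s * balancedKernel s x

lemma integrable (A B : PosOp H) :
    Integrable fun s => (w.density s : ℂ) • (balancedSum A B s).1 := by
  obtain ⟨C, hC⟩ := w.bounded
  refine ((integrable_exp_neg_abs_half.mul_const (‖A.1‖ + ‖B.1‖)).const_mul C).mono'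
    (((Complex.continuous_ofReal.comp w.continuous).smul
      (continuous_balancedSum A B)).aestronglyMeasurable) (Filter.Eventually.of_forall fun s => ?_)
  rw [norm_smul, Complex.norm_real, Real.norm_of_nonneg (w.nonneg s)]
  have := hC s
  have := norm_balancedSum_le A B s
  have := (w.nonneg s).trans (hC s)
  gcongr

lemma integrable_quad (A B : PosOp H) (x : H) :
    Integrable fun s => w.density s * (balancedSum A B s).1.reApplyInnerSelf x := by
  have h := (((w.integrable A B).apply_continuousLinearMap x).const_inner (𝕜 := ℂ) x).re
  refine h.congr (Filter.Eventually.of_forall fun s => ?_)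
  simp [ContinuousLinearMap.reApplyInnerSelf_apply,
    inner_re_symm ((balancedSum A B s).1 x)]

lemma quad_integral (A B : PosOp H) (x : H) :
    (∫ s, (w.density s : ℂ) • (balancedSum A B s).1).reApplyInnerSelf x =
      ∫ s, w.density s * (balancedSum A B s).1.reApplyInnerSelf x := by
  have h := (w.integrable A B).apply_continuousLinearMap x
  rw [ContinuousLinearMap.reApplyInnerSelf_apply, inner_re_symm,
    ContinuousLinearMap.integral_apply (w.integrable A B), ← integral_inner h,
    ← integral_re (h.const_inner (𝕜 := ℂ) x)]
  refine integral_congr_ae (Filter.Eventually.of_forall fun s => ?_)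
  simp [ContinuousLinearMap.reApplyInnerSelf_apply,
    inner_re_symm ((balancedSum A B s).1 x)]

/-- The mean `∫ w(s) (e^{s/2} A : e^{-s/2} B) ds`. -/
noncomputable def mean (A B : PosOp H) : PosOp H :=
  ⟨∫ s, (w.density s : ℂ) • (balancedSum A B s).1, by
    refine integral_nonneg fun s => ?_
    simp only [Pi.zero_apply]
    rw [ContinuousLinearMap.nonneg_iff_isPositive]
    exact ((ContinuousLinearMap.nonneg_iff_isPositive _).1 (balancedSum A B s).2).smul_of_nonneg
      (by exact_mod_cast w.nonneg s)⟩

lemma quad_mean (A B : PosOp H) (x : H) : (w.mean A B).1.reApplyInnerSelf x =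
    ∫ s, w.density s * (balancedSum A B s).1.reApplyInnerSelf x := w.quad_integral A B x

lemma mean_mono {A B C D : PosOp H} (h₁ : A ≤ C) (h₂ : B ≤ D) : w.mean A B ≤ w.mean C D := by
  refine PosOp.le_iff_quad.2 fun x => ?_
  rw [quad_mean, quad_mean]
  refine integral_mono (w.integrable_quad A B x) (w.integrable_quad C D x) fun s => ?_
  exact mul_le_mul_of_nonneg_left (PosOp.le_iff_quad.1 (balancedSum_mono h₁ h₂ s) x) (w.nonneg s)

lemma conj_balancedSum_le (A B C : PosOp H) (s : ℝ) :
    PosOp.conj C (balancedSum A B s) ≤ balancedSum (PosOp.conj C A) (PosOp.conj C B) s := by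
  have h (t : ℝ) (A : PosOp H) :
      PosOp.conj C (PosOp.expSMul t A) = PosOp.expSMul t (PosOp.conj C A) := by
    simp [PosOp.conj, PosOp.expSMul]
  have := conj_parallelSum_le (PosOp.expSMul (s / 2) A) (PosOp.expSMul (-(s / 2)) B) C
  rwa [h, h] at this

lemma conj_mean_le (A B C : PosOp H) :
    PosOp.conj C (w.mean A B) ≤ w.mean (PosOp.conj C A) (PosOp.conj C B) := by
  refine PosOp.le_iff_quad.2 fun x => ?_
  rw [PosOp.quad_conj, quad_mean, quad_mean]
  refine integral_mono (w.integrable_quad A B _) (w.integrable_quad _ _ x) fun s => ?_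
  refine mul_le_mul_of_nonneg_left ?_ (w.nonneg s)
  rw [← PosOp.quad_conj]
  exact PosOp.le_iff_quad.1 (conj_balancedSum_le A B C s) x

lemma mean_decreasesTo {A B : ℕ → PosOp H} {A₀ B₀ : PosOp H} (hA : PosOp.DecreasesTo A A₀)
    (hB : PosOp.DecreasesTo B B₀) :
    PosOp.DecreasesTo (fun n => w.mean (A n) (B n)) (w.mean A₀ B₀) := by
  refine PosOp.decreasesTo_of_tendsto_quad (fun m n h => w.mean_mono (hA.1 h) (hB.1 h))
    (fun n => w.mean_mono (hA.le n) (hB.le n)) fun x => ?_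
  simp only [quad_mean]
  refine tendsto_integral_of_dominated_convergence _
    (fun n => (w.integrable_quad (A n) (B n) x).aestronglyMeasurable)
    (w.integrable_quad (A 0) (B 0) x) (fun n => Filter.Eventually.of_forall fun s => ?_)
    (Filter.Eventually.of_forall fun s => ?_)
  · rw [Real.norm_of_nonneg
      (mul_nonneg (w.nonneg s) (reApplyInnerSelf_nonneg (balancedSum (A n) (B n) s).2 x))]
    exact mul_le_mul_of_nonneg_left (PosOp.le_iff_quad.1
      (balancedSum_mono (hA.1 (Nat.zero_le n)) (hB.1 (Nat.zero_le n)) s) x) (w.nonneg s)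
  · exact (((hA.expSMul _).parallelSum (hB.expSMul _)).tendsto_quad x).const_mul _

lemma mean_comm (A B : PosOp H) : w.mean A B = w.mean B A := by
  refine Subtype.ext ?_
  simp only [mean]
  rw [← integral_neg_eq_self]
  refine integral_congr_ae (Filter.Eventually.of_forall fun s => ?_)
  -- After $s\mapsto-s$ the two scalings have changed places.
  simp only [w.even]
  rw [balancedSum, parallelSum_comm, balancedSum, neg_div, neg_neg]

lemma mean_id_scalar {x : ℝ} (hx : 0 < x) :
    (w.mean (PosOp.id H) (PosOp.scalar H x hx.le)).1 = ((w.repr x : ℝ) : ℂ) • (1 : H →L[ℂ] H) := by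
  have h (s : ℝ) : (balancedSum (PosOp.id H) (PosOp.scalar H x hx.le) s).1 =
      ((balancedKernel s x : ℝ) : ℂ) • (1 : H →L[ℂ] H) := by
    have h1 : PosOp.expSMul (s / 2) (PosOp.id H) = PosOp.scalar H (Real.exp (s / 2))
      (Real.exp_pos _).le := rfl
    have h2 : PosOp.expSMul (-(s / 2)) (PosOp.scalar H x hx.le) =
        PosOp.scalar H (Real.exp (-(s / 2)) * x) (by positivity) := by
      refine Subtype.ext ?_
      simp only [PosOp.expSMul, PosOp.scalar, smul_smul, Complex.ofReal_mul]
    rw [balancedSum, h1, h2, parallelSum_scalar (Real.exp_pos _) (by positivity)]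
    simp only [PosOp.scalar]
    rw [balancedKernel, ← mul_assoc, ← Real.exp_add, add_neg_cancel, Real.exp_zero, one_mul]
  simp only [mean, h, smul_smul]
  rw [integral_smul_const, repr, ← integral_complex_ofReal]
  simp

lemma repr_one : w.repr 1 = 1 := w.normalized

lemma isSymmetricKuboAndoMean : IsSymmetricKuboAndoMean (w.mean (H := H)) where
  joint_monotone _ _ _ _ := w.mean_mono
  transformer := w.conj_mean_le
  upper_semicontinuous _ _ _ _ := w.mean_decreasesTo
  normalized := Subtype.ext <| by
    have h : PosOp.scalar H 1 zero_le_one = PosOp.id H := by simp [PosOp.scalar, PosOp.id]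
    have := w.mean_id_scalar (H := H) one_pos
    rw [h, repr_one] at this
    simpa [PosOp.id] using this
  symmetric := w.mean_comm

lemma isRepresentingFunction : IsRepresentingFunction w.repr (w.mean (H := H)) :=
  fun _ hx => w.mean_id_scalar hx

end MeanWeight

end

/-! ### Operator monotonicity of the representing function -/

/-- Exhibits the kernel as a positive multiple of $1-(1+y)^{-1}$ at $y=e^{-s}x$, a function known to
be operator monotone. -/
lemma balancedKernel_eq {x : ℝ} (hx : 0 ≤ x) (s : ℝ) :
    balancedKernel s x = Real.exp (s / 2) * (1 - (1 + Real.exp (-s) * x)⁻¹) := by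
  have h : Real.exp (-(s / 2)) = Real.exp (s / 2) * Real.exp (-s) := by
    rw [← Real.exp_add]; ring_nf
  have h2 : Real.exp (s / 2) * Real.exp (s / 2) * Real.exp (-s) = 1 := by
    rw [← Real.exp_add, ← Real.exp_add]; ring_nf; simp
  have h3 : 0 < 1 + Real.exp (-s) * x := by positivity
  rw [balancedKernel, h, mul_assoc, ← mul_one_add, div_eq_iff (by positivity)]
  field_simp
  linear_combination -x * h2

lemma balancedKernel_nonneg {x : ℝ} (hx : 0 ≤ x) (s : ℝ) : 0 ≤ balancedKernel s x := by
  unfold balancedKernel; positivity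

lemma balancedKernel_le {x : ℝ} (hx : 0 ≤ x) (s : ℝ) :
    balancedKernel s x ≤ Real.exp (-(|s| / 2)) * (1 + x) := by
  have h : Real.exp (-(s / 2)) * Real.exp (s / 2) = 1 := by rw [← Real.exp_add]; simp
  have h1 := Real.exp_pos (s / 2)
  have h2 := Real.exp_pos (-(s / 2))
  rw [balancedKernel, div_le_iff₀ (by positivity)]
  rcases le_total 0 s with hs | hs
  · rw [abs_of_nonneg hs]
    nlinarith [mul_nonneg (mul_nonneg h2.le h2.le) hx,
      mul_nonneg (mul_nonneg (mul_nonneg h2.le h2.le) hx) hx]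
  · rw [abs_of_nonpos hs, neg_div, neg_neg]
    nlinarith [mul_nonneg (mul_nonneg h1.le h1.le) hx, mul_nonneg h1.le h1.le,
      mul_nonneg hx hx]

lemma continuousOn_balancedKernel :
    ContinuousOn (fun q : ℝ × ℝ => balancedKernel q.1 q.2) (Set.univ ×ˢ Set.Ici 0) := by
  unfold balancedKernel
  refine ContinuousOn.div (by fun_prop) (by fun_prop) fun q hq => ?_
  have : 0 ≤ q.2 := hq.2
  positivity

section

variable {𝒜 : Type*} [CStarAlgebra 𝒜] [PartialOrder 𝒜] [StarOrderedRing 𝒜]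

/-- The nonunital calculus, available since $1-(1+x)^{-1}$ vanishes at $0$, matches the form of
`CFC.monotoneOn_one_sub_one_add_inv_real`. -/
lemma cfc_balancedKernel {a : 𝒜} (ha : 0 ≤ a) (s : ℝ) :
    cfc (balancedKernel s) a =
      Real.exp (s / 2) • cfcₙ (fun x : ℝ => 1 - (1 + x)⁻¹) (Real.exp (-s) • a) := by
  have hcont : ContinuousOn (fun x : ℝ => 1 - (1 + x)⁻¹) (Set.Ici 0) := by
    refine continuousOn_const.sub (ContinuousOn.inv₀ (by fun_prop) fun x hx => ?_)
    have : 0 ≤ x := hx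
    positivity
  have hsa : 0 ≤ Real.exp (-s) • a := smul_nonneg (Real.exp_pos _).le ha
  have himage : (Real.exp (-s) • ·) '' spectrum ℝ a ⊆ Set.Ici (0 : ℝ) := by
    rintro _ ⟨x, hx, rfl⟩
    exact mul_nonneg (Real.exp_pos _).le (spectrum_nonneg_of_nonneg ha hx)
  rw [cfcₙ_eq_cfc (hcont.mono fun x hx => quasispectrum_nonneg_of_nonneg _ hsa x hx) (by simp),
    ← cfc_comp_smul _ _ _ (hcont.mono himage), ← cfc_smul (Real.exp (s / 2)) (fun x => 1 - (1 + Real.exp (-s) • x)⁻¹) a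
      (hcont.comp (by fun_prop) fun x hx => himage ⟨x, hx, rfl⟩)]
  refine cfc_congr fun x hx => ?_
  simp [balancedKernel_eq (spectrum_nonneg_of_nonneg ha hx)]

lemma cfc_balancedKernel_mono {a b : 𝒜} (ha : 0 ≤ a) (hb : 0 ≤ b) (h : a ≤ b) (s : ℝ) :
    cfc (balancedKernel s) a ≤ cfc (balancedKernel s) b := by
  rw [cfc_balancedKernel ha, cfc_balancedKernel hb]
  refine smul_le_smul_of_nonneg_left ?_ (Real.exp_pos _).le
  exact CFC.monotoneOn_one_sub_one_add_inv_real (smul_nonneg (Real.exp_pos _).le ha)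
    (smul_nonneg (Real.exp_pos _).le hb) (smul_le_smul_of_nonneg_left h (Real.exp_pos _).le)

namespace MeanWeight

variable (w : MeanWeight)

lemma continuousOn_uncurry {a : 𝒜} (ha : 0 ≤ a) :
    ContinuousOn (Function.uncurry fun s x => w.density s * balancedKernel s x)
      (Set.univ ×ˢ spectrum ℝ a) :=
  ((w.continuous.comp continuous_fst).continuousOn).mul
    (continuousOn_balancedKernel.mono
      (Set.prod_mono_right fun _ hx => spectrum_nonneg_of_nonneg ha hx))

lemma exists_bound {a : 𝒜} (ha : 0 ≤ a) : ∃ g : ℝ → ℝ, HasFiniteIntegral g volume ∧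
    ∀ s, ∀ x ∈ spectrum ℝ a, ‖w.density s * balancedKernel s x‖ ≤ g s := by
  obtain ⟨C, hC⟩ := w.bounded
  obtain ⟨R, hR⟩ := (spectrum.isBounded (𝕜 := ℝ) a).bddAbove
  refine ⟨fun s => C * (Real.exp (-(|s| / 2)) * (1 + R)),
    ((integrable_exp_neg_abs_half.mul_const _).const_mul C).hasFiniteIntegral, fun s x hx => ?_⟩
  have hx0 := spectrum_nonneg_of_nonneg ha hx
  have := balancedKernel_nonneg hx0 s
  rw [Real.norm_of_nonneg (mul_nonneg (w.nonneg s) this)]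
  exact mul_le_mul (hC s) ((balancedKernel_le hx0 s).trans (by gcongr; exact hR hx)) this
    ((w.nonneg s).trans (hC s))

lemma integrable_cfc {a : 𝒜} (ha : 0 ≤ a) :
    Integrable fun s => cfc (fun x => w.density s * balancedKernel s x) a := by
  obtain ⟨g, hg, hb⟩ := w.exists_bound ha
  exact _root_.integrable_cfc _ g a (w.continuousOn_uncurry ha)
    (Filter.Eventually.of_forall hb) hg

lemma cfc_repr {a : 𝒜} (ha : 0 ≤ a) :
    cfc w.repr a = ∫ s, cfc (fun x => w.density s * balancedKernel s x) a := by
  obtain ⟨g, hg, hb⟩ := w.exists_bound ha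
  exact cfc_integral _ g a (w.continuousOn_uncurry ha) (Filter.Eventually.of_forall hb) hg

/-- The functional calculus commutes with the integral over $s$, so monotonicity of each kernel
passes to the integral. -/
lemma cfc_repr_mono {a b : 𝒜} (ha : 0 ≤ a) (hb : 0 ≤ b) (h : a ≤ b) :
    cfc w.repr a ≤ cfc w.repr b := by
  rw [w.cfc_repr ha, w.cfc_repr hb]
  refine integral_mono (w.integrable_cfc ha) (w.integrable_cfc hb) fun s => ?_
  have hcont {c : 𝒜} (hc : 0 ≤ c) : ContinuousOn (balancedKernel s) (spectrum ℝ c) :=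
    continuousOn_balancedKernel.comp (f := fun x => (s, x)) (by fun_prop)
      fun x hx => ⟨trivial, spectrum_nonneg_of_nonneg hc hx⟩
  simp only []
  rw [cfc_const_mul _ _ _ (hcont ha), cfc_const_mul _ _ _ (hcont hb)]
  exact smul_le_smul_of_nonneg_left (cfc_balancedKernel_mono ha hb h s) (w.nonneg s)

end MeanWeight

end

lemma MeanWeight.isPositiveOperatorMonotone (w : MeanWeight) :
    IsPositiveOperatorMonotone.{u} w.repr :=
  ⟨fun _ hx => integral_nonneg fun s => mul_nonneg (w.nonneg s) (balancedKernel_nonneg hx.le s),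
    fun _ _ _ _ _ _ hA _ hB _ h => w.cfc_repr_mono hA hB h⟩

/-! ### The Poisson formula on a strip -/

namespace Complex

lemma abs_sinh_re_le_norm_sinh (z : ℂ) : |Real.sinh z.re| ≤ ‖sinh z‖ := by
  have h := abs_norm_sub_norm_le (exp z) (exp (-z))
  rw [norm_exp, norm_exp, neg_re] at h
  rw [sinh, norm_div, Real.sinh_eq, abs_div]
  simpa using div_le_div_of_nonneg_right h (zero_le_two (α := ℝ))

/-- The zeros of $\sinh(z/2)$ are the points $2\pi ik$, of which only $0$ lies in the strip. -/
lemma sinh_half_ne_zero {z : ℂ} (hz : |z.im| ≤ Real.pi) (h0 : z ≠ 0) : sinh (z / 2) ≠ 0 := by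
  by_cases hre : z.re = 0
  · have h1 : z / 2 = ((z.im / 2 : ℝ) : ℂ) * I := by
      apply Complex.ext <;> simp [hre]
    have him : z.im ≠ 0 := fun h => h0 (Complex.ext hre h)
    rw [h1, sinh_mul_I, ← ofReal_sin]
    refine mul_ne_zero (ofReal_ne_zero.2 fun h => him ?_) I_ne_zero
    have hpi := Real.pi_pos
    rw [abs_le] at hz
    have := (Real.sin_eq_zero_iff_of_lt_of_lt (by linarith) (by linarith)).1 h
    linarith
  · rw [← norm_pos_iff]
    refine (abs_pos.2 ?_).trans_le (abs_sinh_re_le_norm_sinh (z / 2))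
    rw [Real.sinh_ne_zero]
    simpa using hre

lemma sinh_half_add_pi_mul_I (s : ℝ) :
    sinh ((s + Real.pi * I) / 2) = I * Real.cosh (s / 2) := by
  have : ((s : ℂ) + Real.pi * I) / 2 = (s / 2 : ℝ) + ((Real.pi / 2 : ℝ) : ℂ) * I := by
    push_cast; ring
  rw [this, sinh_add, sinh_mul_I, cosh_mul_I, ← ofReal_sin, ← ofReal_cos]
  simp [mul_comm]

lemma sinh_half_add_neg_pi_mul_I (s : ℝ) :
    sinh ((s + (-Real.pi : ℝ) * I) / 2) = -(I * Real.cosh (s / 2)) := by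
  have : ((s : ℂ) + (-Real.pi : ℝ) * I) / 2 = -((((-s : ℝ) : ℂ) + Real.pi * I) / 2) := by
    push_cast; ring
  rw [this, sinh_neg, sinh_half_add_pi_mul_I, neg_div, Real.cosh_neg]

end Complex

lemma integrable_inv_cosh_half : Integrable fun s : ℝ => (Real.cosh (s / 2))⁻¹ := by
  refine (integrable_exp_neg_abs_half.const_mul 4).mono' ?_ (Filter.Eventually.of_forall fun s => ?_)
  · exact (Continuous.inv₀ (by fun_prop) fun s => (Real.cosh_pos _).ne').aestronglyMeasurable
  · rw [Real.norm_of_nonneg (inv_nonneg.2 (Real.cosh_pos _).le)]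
    have h : (Real.cosh (s / 2))⁻¹ = 2 * balancedKernel s 1 := by
      rw [balancedKernel, Real.cosh_eq]
      field_simp
    linarith [balancedKernel_le zero_le_one s]

lemma integral_inv_cosh_half : ∫ s : ℝ, (Real.cosh (s / 2))⁻¹ = 2 * Real.pi := by
  have hderiv (s : ℝ) : HasDerivAt (fun s => 2 * Real.arctan (Real.sinh (s / 2)))
      (Real.cosh (s / 2))⁻¹ s := by
    have h := (((hasDerivAt_id s).div_const 2).sinh.arctan).const_mul 2
    refine h.congr_deriv ?_
    have h1 := Real.cosh_sq (s / 2)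
    have h2 := (Real.cosh_pos (s / 2)).ne'
    simp only [id]
    rw [add_comm, ← h1]
    field_simp
  have htop : Filter.Tendsto (fun s : ℝ => Real.sinh (s / 2)) Filter.atTop Filter.atTop :=
    Real.sinhOrderIso.tendsto_atTop.comp (Filter.tendsto_id.atTop_div_const two_pos)
  have hbot : Filter.Tendsto (fun s : ℝ => Real.sinh (s / 2)) Filter.atBot Filter.atBot :=
    Real.sinhOrderIso.tendsto_atBot.comp (Filter.tendsto_id.atBot_div_const two_pos)
  rw [integral_of_hasDerivAt_of_tendsto hderiv integrable_inv_cosh_half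
    (((Real.tendsto_arctan_atBot.mono_right nhdsWithin_le_nhds).comp hbot).const_mul 2)
    (((Real.tendsto_arctan_atTop.mono_right nhdsWithin_le_nhds).comp htop).const_mul 2)]
  ring

open Complex in
/-- Poisson formula at the centre of the strip `|Im z| ≤ π`. -/
lemma integral_strip_boundary {f : ℂ → ℂ} (hf : Differentiable ℂ f) {C : ℝ}
    (hC : ∀ z : ℂ, |z.im| ≤ Real.pi → ‖f z‖ ≤ C) :
    ∫ s : ℝ, (f (s + Real.pi * I) + f (s + (-Real.pi : ℝ) * I)) * ((Real.cosh (s / 2))⁻¹ : ℝ) =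
      4 * Real.pi * f 0 := by
  have hpi := Real.pi_pos
  have hC0 : ‖f 0‖ ≤ C := hC 0 (by simp [hpi.le])
  have hCnn : 0 ≤ C := (norm_nonneg _).trans hC0
  let S : ℂ → ℂ := fun z => sinh (z / 2)
  have hS : Differentiable ℂ S := by fun_prop
  -- This is $(f(z)-f(0))/\sinh(z/2)$ with the singularity at $0$ removed. Cauchy's theorem on
  -- rectangles applies to it, and on the horizontal sides $\sinh(z/2)$ becomes $\pm i\cosh(s/2)$.
  let g : ℂ → ℂ := fun z => dslope f 0 z / dslope S 0 z
  have hg (z : ℂ) (hz : z ≠ 0) : g z = (f z - f 0) / sinh (z / 2) := by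
    simp only [g, S, dslope_of_ne _ hz, slope_def_field]
    rw [sub_zero, div_div_div_cancel_right₀ hz]
    simp
  have hSne (z : ℂ) (hz : |z.im| ≤ Real.pi) : dslope S 0 z ≠ 0 := by
    by_cases h0 : z = 0
    · subst h0
      have : HasDerivAt S (1 / 2) 0 := by
        simpa using ((hasDerivAt_id (0 : ℂ)).div_const 2).csinh
      rw [dslope_same, this.deriv]
      norm_num
    · rw [dslope_of_ne _ h0, slope_def_field]
      refine div_ne_zero ?_ (by simpa using h0)
      simpa [S] using sinh_half_ne_zero hz h0
  have hgd : DifferentiableOn ℂ g {z | |z.im| ≤ Real.pi} := by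
    have h1 : DifferentiableOn ℂ (dslope f 0) Set.univ :=
      (differentiableOn_dslope Filter.univ_mem).2 hf.differentiableOn
    have h2 : DifferentiableOn ℂ (dslope S 0) Set.univ :=
      (differentiableOn_dslope Filter.univ_mem).2 hS.differentiableOn
    exact (h1.mono (Set.subset_univ _)).div (h2.mono (Set.subset_univ _)) fun z hz => hSne z hz
  have hne (s : ℝ) : (s : ℂ) + Real.pi * I ≠ 0 := fun h => hpi.ne' (by simpa using congrArg im h)
  have hne' (s : ℝ) : (s : ℂ) + (-Real.pi : ℝ) * I ≠ 0 := fun h =>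
    hpi.ne' (by simpa using congrArg im h)
  have hrect (R : ℝ) : (∫ x : ℝ in -R..R, g (x + (-Real.pi : ℝ) * I)) -
      (∫ x : ℝ in -R..R, g (x + Real.pi * I)) +
      I • (∫ y : ℝ in -Real.pi..Real.pi, g (R + y * I)) -
      I • (∫ y : ℝ in -Real.pi..Real.pi, g ((-R : ℝ) + y * I)) = 0 := by
    have := integral_boundary_rect_eq_zero_of_differentiableOn g ⟨-R, -Real.pi⟩ ⟨R, Real.pi⟩
      (hgd.mono fun z hz => by
        have := hz.2
        simp only [Set.mem_preimage] at this
        rw [Set.uIcc_of_le (by linarith)] at this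
        exact abs_le.2 this)
    simpa using this
  -- The signs $\varepsilon=\pm1$ cover both vertical sides, where $|g|\le 2C/\sinh(R/2)$.
  have hvert (ε : ℝ) (hε : |ε| = 1) : Filter.Tendsto
      (fun R : ℝ => ∫ y : ℝ in -Real.pi..Real.pi, g ((ε * R : ℝ) + y * I)) Filter.atTop (nhds 0) := by
    have hlim : Filter.Tendsto (fun R : ℝ => 2 * C / Real.sinh (R / 2) * |Real.pi - -Real.pi|)
        Filter.atTop (nhds 0) := by
      have htop : Filter.Tendsto (fun s : ℝ => Real.sinh (s / 2)) Filter.atTop Filter.atTop :=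
        Real.sinhOrderIso.tendsto_atTop.comp (Filter.tendsto_id.atTop_div_const two_pos)
      simpa using (htop.const_div_atTop (2 * C)).mul_const |Real.pi - -Real.pi|
    refine squeeze_zero_norm' ?_ hlim
    filter_upwards [Filter.eventually_gt_atTop 0] with R hR
    refine intervalIntegral.norm_integral_le_of_norm_le_const fun y hy => ?_
    rw [Set.uIoc_of_le (by linarith)] at hy
    have him : |((ε * R : ℝ) + y * I : ℂ).im| ≤ Real.pi := by
      simpa using abs_le.2 ⟨hy.1.le, hy.2⟩
    have hε0 : ε ≠ 0 := by rintro rfl; simp at hε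
    have hz : ((ε * R : ℝ) + y * I : ℂ) ≠ 0 := fun h => by
      have := congrArg re h
      simp [hε0, hR.ne'] at this
    rw [hg _ hz, norm_div]
    have hnum : ‖f ((ε * R : ℝ) + y * I) - f 0‖ ≤ 2 * C :=
      (norm_sub_le _ _).trans (by linarith [hC _ him])
    have hden : Real.sinh (R / 2) ≤ ‖sinh (((ε * R : ℝ) + y * I) / 2)‖ := by
      refine le_trans ?_ (abs_sinh_re_le_norm_sinh _)
      have : (((ε * R : ℝ) + y * I : ℂ) / 2).re = ε * (R / 2) := by simp; ring
      rw [this, Real.abs_sinh, abs_mul, hε, one_mul]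
      exact Real.sinh_le_sinh.2 (le_abs_self _)
    have hpos : 0 < Real.sinh (R / 2) := Real.sinh_pos_iff.2 (by linarith)
    gcongr
  have hint (c : ℝ) (hc : |c| ≤ Real.pi) : Integrable fun s : ℝ =>
      (f (s + c * I) - f 0) * ((Real.cosh (s / 2))⁻¹ : ℝ) := by
    refine integrable_inv_cosh_half.ofReal.bdd_mul (c := 2 * C) ?_
      (Filter.Eventually.of_forall fun s => ?_)
    · have := hf.continuous
      exact Continuous.aestronglyMeasurable (by fun_prop)
    · have := hC (s + c * I) (by simpa using hc)
      exact (norm_sub_le _ _).trans (by linarith)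
  have hgp (s : ℝ) : g (s + Real.pi * I) =
      -I * ((f (s + Real.pi * I) - f 0) * ((Real.cosh (s / 2))⁻¹ : ℝ)) := by
    rw [hg _ (hne s), sinh_half_add_pi_mul_I, ofReal_inv, div_eq_mul_inv, mul_inv, inv_I]
    ring
  have hgm (s : ℝ) : g (s + (-Real.pi : ℝ) * I) =
      I * ((f (s + (-Real.pi : ℝ) * I) - f 0) * ((Real.cosh (s / 2))⁻¹ : ℝ)) := by
    rw [hg _ (hne' s), sinh_half_add_neg_pi_mul_I, ofReal_inv, div_eq_mul_inv, inv_neg, mul_inv,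
      inv_I]
    ring
  have hip := hint Real.pi (abs_of_pos hpi).le
  have him := hint (-Real.pi) (by rw [abs_neg, abs_of_pos hpi])
  have hhor (h : ℝ → ℂ) (hh : Integrable h) : Filter.Tendsto (fun R : ℝ => ∫ x in -R..R, h x)
      Filter.atTop (nhds (∫ x, h x)) :=
    intervalIntegral_tendsto_integral hh Filter.tendsto_neg_atTop_atBot Filter.tendsto_id
  have hlim := (((hhor _ (him.const_mul I)).sub (hhor _ (hip.const_mul (-I)))).add
    ((hvert 1 (by simp)).const_smul I)).sub ((hvert (-1) (by simp)).const_smul I)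
  simp only [← hgp, ← hgm, one_mul, neg_one_mul, hrect] at hlim
  have h0 := tendsto_nhds_unique hlim tendsto_const_nhds
  simp only [hgp, hgm, smul_zero, add_zero, sub_zero, integral_const_mul] at h0
  have h1 : (∫ s : ℝ, (f (s + (-Real.pi : ℝ) * I) - f 0) * ((Real.cosh (s / 2))⁻¹ : ℝ)) +
      ∫ s : ℝ, (f (s + Real.pi * I) - f 0) * ((Real.cosh (s / 2))⁻¹ : ℝ) = 0 := by
    have := I_ne_zero
    refine (mul_eq_zero_iff_left this).1 ?_
    linear_combination h0
  rw [← integral_add him hip] at h1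
  -- The subtracted constant returns as $2f(0)\int ds/\cosh(s/2)=4\pi f(0)$.
  have hsplit : (fun s : ℝ => (f (s + Real.pi * I) + f (s + (-Real.pi : ℝ) * I)) *
      ((Real.cosh (s / 2))⁻¹ : ℝ)) = fun s : ℝ =>
      ((f (s + (-Real.pi : ℝ) * I) - f 0) * ((Real.cosh (s / 2))⁻¹ : ℝ) +
        (f (s + Real.pi * I) - f 0) * ((Real.cosh (s / 2))⁻¹ : ℝ)) +
      2 * f 0 * ((Real.cosh (s / 2))⁻¹ : ℝ) := by
    ext s; ring
  have hsum : Integrable fun s : ℝ =>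
      (f (s + (-Real.pi : ℝ) * I) - f 0) * ((Real.cosh (s / 2))⁻¹ : ℝ) +
        (f (s + Real.pi * I) - f 0) * ((Real.cosh (s / 2))⁻¹ : ℝ) := him.add hip
  have hcosh : Integrable fun s : ℝ => (((Real.cosh (s / 2))⁻¹ : ℝ) : ℂ) :=
    integrable_inv_cosh_half.ofReal
  rw [hsplit, integral_add hsum (hcosh.const_mul _), h1, integral_const_mul,
    integral_complex_ofReal, integral_inv_cosh_half]
  push_cast
  ring

/-! ### The density for `molnarExample` -/

/-- The density of the measure representing `molnarExample α`. -/
noncomputable def molnarDensity (α s : ℝ) : ℝ :=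
  Real.pi⁻¹ * (Real.exp (Real.pi / Real.sinh (2 * Real.pi * α) *
    ((1 - Real.cos (2 * α * s) * Real.cosh (2 * Real.pi * α)) / 2)) *
    Real.cos (Real.pi / 2 * Real.sin (2 * α * s)))

-- The two exponentials are complex conjugates, so their sum is twice a real part. As
-- $\kappa\sinh(2\pi\alpha)=\pi$, their phases are $\pm\frac{\pi}{2}\sin(2\alpha s)$.
open Complex in
lemma exp_sin_sq_boundary {α : ℝ} (hα : α ≠ 0) (s : ℝ) :
    exp ((Real.pi / Real.sinh (2 * Real.pi * α) : ℝ) * sin (α * (s + Real.pi * I)) ^ 2) +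
      exp ((Real.pi / Real.sinh (2 * Real.pi * α) : ℝ) * sin (α * (s + (-Real.pi : ℝ) * I)) ^ 2) =
    (2 * Real.pi * molnarDensity α s : ℝ) := by
  set κ : ℝ := Real.pi / Real.sinh (2 * Real.pi * α) with hκ
  have hpi := Real.pi_pos
  have hsinh : Real.sinh (2 * Real.pi * α) ≠ 0 := Real.sinh_ne_zero.2 (by positivity)
  have hκs : κ * Real.sinh (2 * Real.pi * α) = Real.pi := div_mul_cancel₀ _ hsinh
  have hsin (z : ℂ) : sin z ^ 2 = (1 - cos (2 * z)) / 2 := by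
    rw [cos_two_mul, cos_sq']; ring
  have key (ε : ℝ) : sin (α * (s + (ε * Real.pi : ℝ) * I)) ^ 2 =
      ((1 - Real.cos (2 * α * s) * Real.cosh (ε * (2 * Real.pi * α))) / 2 : ℝ) +
      (Real.sin (2 * α * s) * Real.sinh (ε * (2 * Real.pi * α)) / 2 : ℝ) * I := by
    have : 2 * (α * (s + (ε * Real.pi : ℝ) * I)) =
        ((2 * α * s : ℝ) : ℂ) + ((ε * (2 * Real.pi * α) : ℝ) : ℂ) * I := by push_cast; ring
    rw [hsin, this, cos_add, cos_mul_I, sin_mul_I, ← ofReal_cos, ← ofReal_sin, ← ofReal_cosh,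
      ← ofReal_sinh]
    push_cast
    ring
  have h1 := key 1
  have h2 := key (-1)
  simp only [one_mul, neg_one_mul, Real.cosh_neg, Real.sinh_neg] at h1 h2
  rw [h1, h2, mul_add, mul_add, exp_add, exp_add, ← mul_add, ← mul_assoc, ← mul_assoc,
    ← ofReal_mul, ← ofReal_mul, ← ofReal_mul]
  have h3 : κ * (Real.sin (2 * α * s) * Real.sinh (2 * Real.pi * α) / 2) =
      Real.pi / 2 * Real.sin (2 * α * s) := by linear_combination Real.sin (2 * α * s) / 2 * hκs
  have h4 : κ * (Real.sin (2 * α * s) * -Real.sinh (2 * Real.pi * α) / 2) =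
      -(Real.pi / 2 * Real.sin (2 * α * s)) := by
    linear_combination -Real.sin (2 * α * s) / 2 * hκs
  rw [h3, h4, ofReal_neg, ← two_cos, ← ofReal_cos, ← ofReal_exp, molnarDensity, ← hκ]
  push_cast
  field_simp

lemma Complex.norm_sin_le (z : ℂ) : ‖Complex.sin z‖ ≤ Real.exp |z.im| := by
  have h1 : ‖Complex.exp (-z * Complex.I)‖ ≤ Real.exp |z.im| := by
    rw [Complex.norm_exp]; simpa using le_abs_self z.im
  have h2 : ‖Complex.exp (z * Complex.I)‖ ≤ Real.exp |z.im| := by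
    rw [Complex.norm_exp]; simpa using neg_le_abs z.im
  rw [Complex.sin, norm_div, norm_mul, Complex.norm_I, mul_one, Complex.norm_ofNat,
    div_le_iff₀ two_pos]
  linarith [norm_sub_le (Complex.exp (-z * Complex.I)) (Complex.exp (z * Complex.I))]

/-- The Poisson formula for the translate $z\mapsto\exp(\kappa\sin^2(\alpha(z+u)))$, whose value at
the centre is the exponential on the right. -/
lemma integral_molnarDensity {α : ℝ} (hα : α ≠ 0) (u : ℝ) :
    ∫ s : ℝ, molnarDensity α (s + u) * (Real.cosh (s / 2))⁻¹ =
      2 * Real.exp (Real.pi / Real.sinh (2 * Real.pi * α) * Real.sin (α * u) ^ 2) := by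
  set κ : ℝ := Real.pi / Real.sinh (2 * Real.pi * α) with hκ
  have hpi := Real.pi_pos
  let f : ℂ → ℂ := fun z => Complex.exp (κ * Complex.sin (α * (z + u)) ^ 2)
  have hf : Differentiable ℂ f := by fun_prop
  have hC (z : ℂ) (hz : |z.im| ≤ Real.pi) :
      ‖f z‖ ≤ Real.exp (|κ| * Real.exp (|α| * Real.pi) ^ 2) := by
    rw [Complex.norm_exp, Real.exp_le_exp]
    refine (Complex.re_le_norm _).trans ?_
    rw [norm_mul, Complex.norm_real, Real.norm_eq_abs, norm_pow]
    gcongr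
    refine (Complex.norm_sin_le _).trans ?_
    have : (α * (z + u) : ℂ).im = α * z.im := by simp
    rw [this, abs_mul]
    gcongr
  have h := integral_strip_boundary hf hC
  have hsum (s : ℝ) : f (s + Real.pi * Complex.I) + f (s + (-Real.pi : ℝ) * Complex.I) =
      (2 * Real.pi * molnarDensity α (s + u) : ℝ) := by
    rw [← exp_sin_sq_boundary hα]
    simp only [f, hκ, Complex.ofReal_add, add_right_comm _ (u : ℂ)]
  simp only [hsum, ← Complex.ofReal_mul] at h
  have h0 : f 0 = (Real.exp (κ * Real.sin (α * u) ^ 2) : ℝ) := by simp [f]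
  rw [integral_complex_ofReal, h0] at h
  have h' : ∫ s : ℝ, 2 * Real.pi * molnarDensity α (s + u) * (Real.cosh (s / 2))⁻¹ =
      4 * Real.pi * Real.exp (κ * Real.sin (α * u) ^ 2) := by exact_mod_cast h
  simp only [mul_assoc, integral_const_mul] at h'
  have : (2 * Real.pi) * ∫ s : ℝ, molnarDensity α (s + u) * (Real.cosh (s / 2))⁻¹ =
      (2 * Real.pi) * (2 * Real.exp (κ * Real.sin (α * u) ^ 2)) := by linarith
  exact mul_left_cancel₀ (by positivity) this

lemma integral_molnarDensity_mul_balancedKernel {α : ℝ} (hα : α ≠ 0) {x : ℝ} (hx : 0 < x) :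
    ∫ s, molnarDensity α s * balancedKernel s x = molnarExample α x := by
  rw [← integral_add_right_eq_self _ (Real.log x)]
  have hk (s : ℝ) : balancedKernel (s + Real.log x) x = √x / 2 * (Real.cosh (s / 2))⁻¹ := by
    have h1 : Real.exp ((s + Real.log x) / 2) = Real.exp (s / 2) * √x := by
      rw [add_div, Real.exp_add, Real.exp_half, Real.exp_half, Real.exp_log hx]
    have h2 : Real.exp (-((s + Real.log x) / 2)) = Real.exp (-(s / 2)) / √x := by
      rw [Real.exp_neg, h1, mul_inv, ← Real.exp_neg, ← div_eq_mul_inv]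
    have h3 : 0 < √x := Real.sqrt_pos.2 hx
    have h4 : √x * √x = x := Real.mul_self_sqrt hx.le
    have h5 : x / √x = √x := Real.div_sqrt
    rw [balancedKernel, h1, h2, Real.cosh_eq, div_mul_eq_mul_div, mul_div_assoc, h5, ← add_mul]
    have h6 : 0 < Real.exp (s / 2) + Real.exp (-(s / 2)) := by positivity
    field_simp
    linarith
  have hi := integral_molnarDensity hα (Real.log x)
  have : ∀ s, molnarDensity α (s + Real.log x) * balancedKernel (s + Real.log x) x =
      √x / 2 * (molnarDensity α (s + Real.log x) * (Real.cosh (s / 2))⁻¹) := fun s => by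
    rw [hk]; ring
  simp only [this, integral_const_mul, hi, molnarExample]
  ring_nf

/-- The weight whose representing function is `molnarExample α`. -/
noncomputable def molnarWeight {α : ℝ} (hα : α ≠ 0) : MeanWeight where
  density := molnarDensity α
  continuous := by unfold molnarDensity; fun_prop
  nonneg s := by
    have hpi := Real.pi_pos
    have h1 := Real.sin_le_one (2 * α * s)
    have h2 := Real.neg_one_le_sin (2 * α * s)
    -- The choice of $\kappa$ matters here: the phase never leaves $[-\pi/2,\pi/2]$.
    have : 0 ≤ Real.cos (Real.pi / 2 * Real.sin (2 * α * s)) :=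
      Real.cos_nonneg_of_neg_pi_div_two_le_of_le (by nlinarith) (by nlinarith)
    unfold molnarDensity
    positivity
  bounded := by
    refine ⟨Real.pi⁻¹ * (Real.exp (|Real.pi / Real.sinh (2 * Real.pi * α)| *
      ((1 + Real.cosh (2 * Real.pi * α)) / 2)) * 1), fun s => ?_⟩
    have hpi := Real.pi_pos
    have hc := Real.cosh_pos (2 * Real.pi * α)
    unfold molnarDensity
    refine mul_le_mul_of_nonneg_left ?_ (inv_nonneg.2 hpi.le)
    refine mul_le_mul_of_nonneg (Real.exp_le_exp.2 ?_) (Real.cos_le_one _) (Real.exp_pos _).le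
      zero_le_one
    refine (le_abs_self _).trans ?_
    rw [abs_mul, abs_div _ (2 : ℝ), abs_two]
    gcongr
    refine (abs_sub _ _).trans ?_
    rw [abs_one, abs_mul, abs_of_pos hc]
    gcongr
    exact mul_le_of_le_one_left hc.le (Real.abs_cos_le_one _)
  even s := by simp [molnarDensity]
  normalized := by
    rw [integral_molnarDensity_mul_balancedKernel hα one_pos]
    simp [molnarExample]

lemma molnarWeight_repr {α : ℝ} (hα : α ≠ 0) {x : ℝ} (hx : 0 < x) :
    (molnarWeight hα).repr x = molnarExample α x :=
  integral_molnarDensity_mul_balancedKernel hα hx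

/-! ### The functional equation and distinctness of the means -/

lemma molnarExample_functional_equation {α : ℝ} (hα : α ≠ 0) {x : ℝ} (hx : 0 < x) :
    molnarExample α (Real.exp (Real.pi / (2 * α)) ^ 2 * x) =
      Real.exp (Real.pi / (2 * α)) * molnarExample α x := by
  have h1 : √(Real.exp (Real.pi / (2 * α)) ^ 2 * x) = Real.exp (Real.pi / (2 * α)) * √x := by
    rw [Real.sqrt_mul (by positivity), Real.sqrt_sq (Real.exp_pos _).le]
  have h2 : α * Real.log (Real.exp (Real.pi / (2 * α)) ^ 2 * x) = α * Real.log x + Real.pi := by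
    rw [Real.log_mul (by positivity) hx.ne', Real.log_pow, Real.log_exp]
    push_cast
    field_simp
    ring
  rw [molnarExample, molnarExample, h1, h2, Real.sin_add_pi, neg_sq, mul_assoc]

/-- The set of $x$ where the mean agrees with the geometric mean on $(I,xI)$ serves as an invariant
that tells the means apart. -/
lemma molnarExample_eq_sqrt_iff {α : ℝ} (hα : α ≠ 0) {x : ℝ} (hx : 0 < x) :
    molnarExample α x = √x ↔ Real.sin (α * Real.log x) = 0 := by
  have hs : √x ≠ 0 := (Real.sqrt_pos.2 hx).ne'
  have hsinh : Real.sinh (2 * Real.pi * α) ≠ 0 :=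
    Real.sinh_ne_zero.2 (mul_ne_zero (by positivity) hα)
  rw [molnarExample, mul_eq_left₀ hs, Real.exp_eq_one_iff]
  simp [hsinh, Real.pi_ne_zero]

section

variable {H : Type u} [NormedAddCommGroup H] [InnerProductSpace ℂ H] [CompleteSpace H]

lemma isRepresentingFunction_molnarWeight {α : ℝ} (hα : α ≠ 0) :
    IsRepresentingFunction (molnarExample α) ((molnarWeight hα).mean (H := H)) := fun x hx => by
  rw [← molnarWeight_repr hα hx]
  exact (molnarWeight hα).isRepresentingFunction x hx

lemma isMolnarMean_molnarWeight {α : ℝ} (hα : α ≠ 0) :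
    IsMolnarMean ((molnarWeight hα).mean (H := H)) := by
  refine ⟨(molnarWeight hα).isSymmetricKuboAndoMean, (molnarWeight hα).repr,
    (molnarWeight hα).isPositiveOperatorMonotone, (molnarWeight hα).isRepresentingFunction,
    Real.exp (Real.pi / (2 * α)), Real.exp_pos _, ?_, fun x hx => ?_⟩
  · rw [Ne, Real.exp_eq_one_iff]
    have := Real.pi_pos
    positivity
  · rw [molnarWeight_repr hα hx, molnarWeight_repr hα (by positivity)]
    exact molnarExample_functional_equation hα hx

lemma smul_one_injective [Nontrivial H] {a b : ℝ}
    (h : (a : ℂ) • (1 : H →L[ℂ] H) = (b : ℂ) • (1 : H →L[ℂ] H)) : a = b := by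
  exact_mod_cast smul_left_injective ℂ (one_ne_zero (α := H →L[ℂ] H)) h

lemma IsRepresentingFunction.eqOn [Nontrivial H] {f g : ℝ → ℝ} {σ : PosOp H → PosOp H → PosOp H}
    (hf : IsRepresentingFunction f σ) (hg : IsRepresentingFunction g σ) {x : ℝ} (hx : 0 < x) :
    f x = g x :=
  smul_one_injective ((hf x hx).symm.trans (hg x hx))

lemma IsGeometricMean.isRepresentingFunction {σ : PosOp H → PosOp H → PosOp H}
    (h : IsGeometricMean σ) : IsRepresentingFunction Real.sqrt σ := fun x hx => by
  have hu : IsUnit (PosOp.scalar H x hx.le).1 := by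
    have : IsUnit ((x : ℂ) • (1 : H →L[ℂ] H)) :=
      isUnit_one.smul (Units.mk0 (x : ℂ) (by exact_mod_cast hx.ne'))
    exact this
  have h1 : CFC.sqrt (PosOp.id H).1 = 1 := CFC.sqrt_one
  have h2 : CFC.sqrt (PosOp.scalar H x hx.le).1 = (PosOp.scalar H (√x) (Real.sqrt_nonneg x)).1 := by
    refine CFC.sqrt_unique ?_ (PosOp.scalar H (√x) (Real.sqrt_nonneg x)).2
    simp only [PosOp.scalar]
    rw [smul_mul_smul_comm, one_mul, ← Complex.ofReal_mul, Real.mul_self_sqrt hx.le]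
  rw [h _ _ isUnit_one hu, h1, Ring.inverse_one, one_mul, mul_one, one_mul, mul_one, h2]
  rfl

lemma not_isGeometricMean_molnarWeight [Nontrivial H] {α : ℝ} (hα : α ≠ 0) :
    ¬ IsGeometricMean ((molnarWeight hα).mean (H := H)) := fun h => by
  -- At $x=e^{\pi/(2\alpha)}$ the sine equals $1$.
  have hx := Real.exp_pos (Real.pi / (2 * α))
  have h1 := (isRepresentingFunction_molnarWeight (H := H) hα).eqOn h.isRepresentingFunction hx
  rw [molnarExample_eq_sqrt_iff hα hx, Real.log_exp,
    show α * (Real.pi / (2 * α)) = Real.pi / 2 by field_simp, Real.sin_pi_div_two] at h1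
  exact one_ne_zero h1

lemma molnarWeight_mean_ne [Nontrivial H] {α β : ℝ} (hα : 0 < α) (hβ : 0 < β) (h : α < β) :
    (molnarWeight hα.ne').mean (H := H) ≠ (molnarWeight hβ.ne').mean := fun heq => by
  -- At $x=e^{\pi/\beta}$ the sine for $\beta$ vanishes, while $\alpha\log x=\pi\alpha/\beta$ lies
  -- strictly between $0$ and $\pi$.
  have hx := Real.exp_pos (Real.pi / β)
  have h1 := isRepresentingFunction_molnarWeight (H := H) hα.ne'
  rw [heq] at h1
  have h2 := h1.eqOn (isRepresentingFunction_molnarWeight hβ.ne') hx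
  rw [(molnarExample_eq_sqrt_iff hβ.ne' hx).2
    (by rw [Real.log_exp, mul_div_cancel₀ _ hβ.ne', Real.sin_pi]),
    molnarExample_eq_sqrt_iff hα.ne' hx, Real.log_exp] at h2
  refine (Real.sin_pos_of_pos_of_lt_pi (by positivity) ?_).ne' h2
  rw [← mul_div_assoc, div_lt_iff₀ hβ, mul_comm]
  exact mul_lt_mul_of_pos_left h Real.pi_pos

end

theorem theorem1p4 (H : Type u) [NormedAddCommGroup H] [InnerProductSpace ℂ H] [CompleteSpace H]
    [Nontrivial H] :
    {σ : PosOp H → PosOp H → PosOp H | IsMolnarMean σ}.Infinite ∧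
    ∀ α : ℝ, α ≠ 0 → ∃ σ : PosOp H → PosOp H → PosOp H,
      IsMolnarMean σ ∧ IsRepresentingFunction (molnarExample α) σ ∧ ¬ IsGeometricMean σ := by
  refine ⟨?_, fun α hα => ⟨(molnarWeight hα).mean, isMolnarMean_molnarWeight hα,
    isRepresentingFunction_molnarWeight hα, not_isGeometricMean_molnarWeight hα⟩⟩
  have hpos (n : ℕ) : (0 : ℝ) < n + 1 := n.cast_add_one_pos
  refine Set.infinite_of_injective_forall_mem
    (f := fun n : ℕ => (molnarWeight (hpos n).ne').mean (H := H)) (fun m n hmn => ?_)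
    fun n => isMolnarMean_molnarWeight _
  by_contra hne
  rcases lt_or_gt_of_ne hne with h | h
  · exact molnarWeight_mean_ne (hpos m) (hpos n) (by exact_mod_cast Nat.succ_lt_succ h) hmn
  · exact molnarWeight_mean_ne (hpos n) (hpos m) (by exact_mod_cast Nat.succ_lt_succ h) hmn.symm
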